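/- Let $\mathbb F_q$ be the finite field with $q$ elements and let $\mathbb F_q((X^{-1}))$ be the field of formal Laurent series $f=a_dX^d+a_{d-1}X^{d-1}+\cdots$ ($d\in\mathbb Z$, $a_i\in\mathbb F_q$), with the norm $|f|=q^{d}$ if $a_d\neq 0$ and $|0|=0$, and with the fractional part $\{f\}=a_{-1}X^{-1}+a_{-2}X^{-2}+\cdots$. Let $\mathbb L=\{f\in\mathbb F_q((X^{-1})) : |f|<1\}$, a compact topological group under addition, equipped with its Haar probability measure. Let $(l_n)_{n\ge 0}$ be a non-decreasing sequence of non-negative integers, and let $f\in\mathbb L$ be irrational (not a quotient of two polynomials in $\mathbb F_q[X]$), with principal convergents $P_k/Q_k$, $k\ge 0$, of its continued fraction expansion; put $n_k=\deg Q_k$ (so $Q_0=1$ and $n_0=0$). Then, for almost every $g\in\mathbb L$, the following equivalence holds: \[ |\{Qf\}-g|<\frac1{q^{l_n}},\quad \deg Q=n,\qquad\text{for infinitely many } Q\in\mathbb F_q[X] \] if and only if \[ \sum_{k=0}^{\infty}\ \sum_{n=n_k}^{n_{k+1}-1} q^{\,n-\max\{n_{k+1},\,l_n\}}=\infty . \]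 That is, if the series diverges, then almost every $g$ admits infinitely many such $Q$; if it converges, then almost every $g$ admits only finitely many. -/

import Mathlib

open MeasureTheory

noncomputable section

namespace FormalLaurent

/-- The field `F((X⁻¹))` of formal Laurent series in `X⁻¹`.  It is Mathlib's field of Laurent
series, whose variable is read as `X⁻¹`: the coefficient with index `m` is that of `X ^ (-m)`. -/
abbrev Series (F : Type*) [Field F] : Type _ := LaurentSeries F

section Basic

variable {F : Type*} [Field F]

/-- The inclusion `F[X] → F((X⁻¹))`; the polynomial variable `X` is the series with the single
coefficient `1` at index `-1`. -/
def ofPoly : Polynomial F →+* Series F :=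
  Polynomial.eval₂RingHom HahnSeries.C (HahnSeries.single (-1 : ℤ) (1 : F))

/-- The generalized degree of a series `≠ 0`: the largest `n` such that `X ^ n` has a nonzero
coefficient. (The value at `0` is not used.) -/
def deg (f : Series F) : ℤ := -f.order

open Classical in
/-- The norm `|f| = q ^ deg f`, `|0| = 0`, where `q` is the cardinality of `F`. -/
def absVal (f : Series F) : ℝ := if f = 0 then 0 else (Nat.card F : ℝ) ^ deg f

/-- The fractional part `{f} = a₋₁ X⁻¹ + a₋₂ X⁻² + ⋯` of `f = ∑ aₙ Xⁿ`. -/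
def fract (f : Series F) : Series F where
  coeff m := if 0 < m then f.coeff m else 0
  isPWO_support' := f.isPWO_support.mono fun m hm => by
    simp only [Function.mem_support, ne_eq, ite_eq_right_iff, not_forall] at hm
    exact hm.2

/-- The polynomial part `a₀ + a₁ X + ⋯ + a_d X ^ d` (`d = deg f`) of `f = ∑ aₙ Xⁿ`. -/
def polyPart (f : Series F) : Polynomial F :=
  ∑ i ∈ Finset.range ((deg f).toNat + 1), Polynomial.monomial i (f.coeff (-(i : ℤ)))

/-- `f` is irrational if it is not a quotient of two polynomials. -/
def IsIrrational (f : Series F) : Prop :=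
  ∀ P Q : Polynomial F, Q ≠ 0 → f ≠ ofPoly P / ofPoly Q

/-- The complete quotients of the continued fraction algorithm: `f₀ = f`, `fₖ₊₁ = 1 / {fₖ}`. -/
def completeQuot (f : Series F) : ℕ → Series F
  | 0 => f
  | k + 1 => (fract (completeQuot f k))⁻¹

/-- The partial quotients `Aₖ` of the continued fraction expansion `f = [A₀; A₁, A₂, …]`. -/
def partialQuot (f : Series F) (k : ℕ) : Polynomial F := polyPart (completeQuot f k)

/-- The numerators `Pₖ` of the principal convergents `Pₖ / Qₖ = [A₀; A₁, …, Aₖ]` of `f`. -/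
def convNum (f : Series F) : ℕ → Polynomial F
  | 0 => partialQuot f 0
  | 1 => partialQuot f 1 * partialQuot f 0 + 1
  | k + 2 => partialQuot f (k + 2) * convNum f (k + 1) + convNum f k

/-- The denominators `Qₖ` of the principal convergents `Pₖ / Qₖ = [A₀; A₁, …, Aₖ]` of `f`. -/
def convDen (f : Series F) : ℕ → Polynomial F
  | 0 => 1
  | 1 => partialQuot f 1
  | k + 2 => partialQuot f (k + 2) * convDen f (k + 1) + convDen f k

/-- `nₖ = deg Qₖ`. -/
def convDeg (f : Series F) (k : ℕ) : ℕ := (convDen f k).natDegree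

theorem absVal_nonneg (f : Series F) : 0 ≤ absVal f := by
  unfold absVal
  split_ifs
  · exact le_rfl
  · positivity

@[simp] theorem absVal_zero : absVal (0 : Series F) = 0 := by simp [absVal]

theorem absVal_neg (f : Series F) : absVal (-f) = absVal f := by
  by_cases hf : f = 0
  · rw [hf, neg_zero]
  · rw [absVal, absVal, if_neg hf, if_neg (neg_ne_zero.mpr hf), deg, deg, HahnSeries.order_neg]

end Basic

section UnitBall

variable {F : Type*} [Field F] [Finite F]

theorem one_lt_q (F : Type*) [Field F] [Finite F] : (1 : ℝ) < Nat.card F := by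
  exact_mod_cast Finite.one_lt_card

theorem absVal_le_zpow_iff {f : Series F} {m : ℤ} :
    absVal f ≤ (Nat.card F : ℝ) ^ (-m) ↔ ∀ n < m, f.coeff n = 0 := by
  have hq := one_lt_q F
  have hq0 : (0 : ℝ) < Nat.card F := by linarith
  by_cases hf : f = 0
  · simp [absVal, hf, (zpow_pos hq0 _).le]
  · rw [absVal, if_neg hf, zpow_le_zpow_iff_right₀ hq, deg, neg_le_neg_iff,
      HahnSeries.le_order_iff_forall hf]

theorem absVal_lt_one_iff {f : Series F} : absVal f < 1 ↔ ∀ n < 1, f.coeff n = 0 := by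
  have hq := one_lt_q F
  have hq0 : (0 : ℝ) < Nat.card F := by linarith
  by_cases hf : f = 0
  · simp [absVal, hf]
  · rw [absVal, if_neg hf, ← zpow_zero (Nat.card F : ℝ), zpow_lt_zpow_iff_right₀ hq, deg,
      ← HahnSeries.le_order_iff_forall hf]
    omega

theorem eq_zero_of_absVal_eq_zero {f : Series F} (h : absVal f = 0) : f = 0 := by
  have hq := one_lt_q F
  by_contra hf
  rw [absVal, if_neg hf] at h
  exact (zpow_pos (by linarith : (0 : ℝ) < Nat.card F) _).ne' h

theorem absVal_add_le_max (f g : Series F) : absVal (f + g) ≤ max (absVal f) (absVal g) := by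
  have key : ∀ f g : Series F, absVal f ≤ absVal g → absVal (f + g) ≤ absVal g := by
    intro f g h
    by_cases hg : g = 0
    · subst hg
      rw [absVal_zero] at h
      rw [add_zero, absVal_zero]
      exact h
    · have e : absVal g = (Nat.card F : ℝ) ^ (-g.order) := by rw [absVal, if_neg hg, deg]
      have h2 : absVal g ≤ (Nat.card F : ℝ) ^ (-g.order) := e.le
      rw [e] at h ⊢
      rw [absVal_le_zpow_iff] at h h2 ⊢
      intro n hn
      simp [h n hn, h2 n hn]
  rcases le_total (absVal f) (absVal g) with h | h
  · exact (key f g h).trans (le_max_right _ _)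
  · rw [add_comm]
    exact (key g f h).trans (le_max_left _ _)

theorem absVal_add_le (f g : Series F) : absVal (f + g) ≤ absVal f + absVal g :=
  (absVal_add_le_max f g).trans
    (max_le (by linarith [absVal_nonneg g]) (by linarith [absVal_nonneg f]))

variable (F) in
/-- The additive group of all series `f` with `|f| < 1`. -/
def ballSubgroup : AddSubgroup (Series F) where
  carrier := {f | absVal f < 1}
  zero_mem' := by simp
  add_mem' {f g} hf hg := (absVal_add_le_max f g).trans_lt (max_lt hf hg)
  neg_mem' {f} hf := by
    rw [Set.mem_ofPred_eq, absVal_neg]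
    exact hf

variable (F) in
/-- The set `𝕃 = {f : |f| < 1}`, as a type of its own, so that its topology is the one that comes
from the norm. -/
def UnitBall : Type _ := ballSubgroup F

instance : AddCommGroup (UnitBall F) := inferInstanceAs (AddCommGroup (ballSubgroup F))

/-- The underlying series of an element of `𝕃`. -/
def UnitBall.val (f : UnitBall F) : Series F := Subtype.val (p := (· ∈ ballSubgroup F)) f

instance : Coe (UnitBall F) (Series F) := ⟨UnitBall.val⟩

/-- `𝕃` carries the restriction of the norm, and the metric and topology induced by it. -/
instance : NormedAddCommGroup (UnitBall F) :=
  AddGroupNorm.toNormedAddCommGroup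
    { toFun := fun f => absVal f.val
      map_zero' := absVal_zero
      add_le' := fun f g => absVal_add_le f.val g.val
      neg' := fun f => absVal_neg f.val
      eq_zero_of_map_eq_zero' := fun _ h => Subtype.ext (eq_zero_of_absVal_eq_zero h) }

theorem dist_eq (f g : UnitBall F) : dist f g = absVal (f.val - g.val) := dist_eq_norm_sub f g

/-- The element `∑ᵢ aᵢ X ^ (-i-1)` of `𝕃` with a given sequence of coefficients. -/
def UnitBall.mk (a : ℕ → F) : UnitBall F :=
  ⟨HahnSeries.ofSuppBddBelow (fun m : ℤ => if 0 < m then a (m - 1).toNat else 0)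
    ⟨0, fun m hm => by
      simp only [Function.mem_support, ne_eq, ite_eq_right_iff, not_forall] at hm
      exact hm.1.le⟩, absVal_lt_one_iff.mpr fun n hn => if_neg (by omega)⟩

theorem UnitBall.mk_coeff (a : ℕ → F) (m : ℤ) :
    (UnitBall.mk a).val.coeff m = if 0 < m then a (m - 1).toNat else 0 := rfl

instance : CompactSpace (UnitBall F) := by
  let _ : TopologicalSpace F := ⊥
  have _ : DiscreteTopology F := ⟨rfl⟩
  have hq := one_lt_q F
  have hq0 : (0 : ℝ) < Nat.card F := by linarith
  have hc : Continuous (UnitBall.mk : (ℕ → F) → UnitBall F) := by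
    rw [continuous_iff_continuousAt]
    intro a
    rw [ContinuousAt, Metric.tendsto_nhds]
    intro ε hε
    obtain ⟨N, hN⟩ := exists_pow_lt_of_lt_one hε (inv_lt_one_of_one_lt₀ hq)
    have hev : ∀ᶠ b in nhds a, ∀ i ∈ Finset.range N, b i = a i := by
      rw [Filter.eventually_all_finset]
      intro i _
      have h1 : Filter.Tendsto (fun b : ℕ → F => b i) (nhds a) (nhds (a i)) :=
        (continuous_apply i).continuousAt
      exact h1 (by simp : {a i} ∈ nhds (a i))
    filter_upwards [hev] with b hb
    refine lt_of_le_of_lt ?_ hN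
    rw [dist_eq, inv_pow, ← zpow_natCast, ← zpow_neg, absVal_le_zpow_iff]
    intro n hn
    rw [HahnSeries.coeff_sub, UnitBall.mk_coeff, UnitBall.mk_coeff]
    split_ifs with h
    · rw [hb _ (by rw [Finset.mem_range]; omega), sub_self]
    · simp
  have hs : Function.Surjective (UnitBall.mk : (ℕ → F) → UnitBall F) := by
    intro f
    refine ⟨fun i => f.val.coeff (i + 1), Subtype.ext (HahnSeries.ext (funext fun m => ?_))⟩
    change (UnitBall.mk _).val.coeff m = f.val.coeff m
    rw [UnitBall.mk_coeff]
    split_ifs with h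
    · congr 1
      omega
    · exact ((absVal_lt_one_iff.mp f.2) m (by omega)).symm
  exact hs.compactSpace hc

instance : MeasurableSpace (UnitBall F) := borel _

instance : BorelSpace (UnitBall F) := ⟨rfl⟩

variable (F) in
/-- The Haar probability measure on the compact group `𝕃`. -/
def haar : Measure (UnitBall F) := Measure.addHaarMeasure ⊤

instance : IsProbabilityMeasure (haar F) :=
  ⟨Measure.addHaarMeasure_self (K₀ := (⊤ : TopologicalSpace.PositiveCompacts (UnitBall F)))⟩

instance : (haar F).IsAddLeftInvariant :=
  inferInstanceAs (Measure.addHaarMeasure ⊤ : Measure (UnitBall F)).IsAddLeftInvariant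

end UnitBall

end FormalLaurent

end

/-! Write `n_k` for `convDeg f.val k`, and let `k` be the index with `n_k ≤ n < n_{k+1}`. The
inequality says that `g` lies in the ball of measure `q^(-l n)` around `{Qf}`, so the theorem is a
Borel–Cantelli statement about these balls. Two facts on the additive map `Q ↦ {Qf}` carry it. By
`eq_zero_of_coords_orbit_eq_zero`, the polynomials of degree `< n_k` correspond bijectively to the
possible first `n_k` coefficients of `{Rf}`. By `fract_ofPoly_mul_convDen_mul`, `{A Q_k f}` has
order exactly `n_{k+1} - deg A` when `deg A < n_{k+1}`. Division `Q = A Q_k + R` then describes the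
whole orbit.

Convergence: `{Qf}` is close to `{Rf}`, and there are only `q^(n_k)` remainders `R`. The balls of
degree `n` are therefore covered by a set of measure at most `q` times the `n`-th term, together
with a set depending only on `k` whose measure, for `k ≥ 1`, is at most `q` times the last term of
the preceding block (`mem_cover`, `haar_fineCover_le`, `haar_coarseCover_succ_le`). The first
Borel–Cantelli lemma finishes.

Divergence: shrink the balls to level `L n = max(n_{k+1}, l n)`, which makes those of equal degree
disjoint. Balls of degrees `m < n` are independent up to an error `excess`, nonzero only for `n`
below a bound depending on `m` and of total sum at most `1` (`card_filter_mul_le`,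
`sum_excess_le_one`). Hence the variance of the counting function is at most a constant times its
mean, and `ae_infinite_of_second_moment` applies. -/

noncomputable section

namespace FormalLaurent

open Polynomial

/-! ### Continued fractions: degrees of the denominators and orders of the remainders. -/

section ContinuedFraction

variable {F : Type*} [Field F]

theorem ofPoly_monomial (n : ℕ) (a : F) :
    ofPoly (monomial n a) = HahnSeries.single (-(n : ℤ)) a := by
  simp [ofPoly, HahnSeries.C_apply, HahnSeries.single_pow]

theorem ofPoly_coeff (P : F[X]) (m : ℤ) :
    (ofPoly P).coeff m = if m ≤ 0 then P.coeff (-m).toNat else 0 := by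
  induction P using Polynomial.induction_on' with
  | add P Q hP hQ =>
    rw [map_add, HahnSeries.coeff_add, hP, hQ]
    split_ifs <;> simp
  | monomial n a =>
    rw [ofPoly_monomial, HahnSeries.coeff_single, coeff_monomial]
    split_ifs <;> first | rfl | omega

theorem ofPoly_injective : Function.Injective (ofPoly : F[X] →+* Series F) := by
  rw [injective_iff_map_eq_zero]
  intro P hP
  ext i
  have h := ofPoly_coeff P (-(i : ℤ))
  rw [hP] at h
  simpa using h.symm

theorem ofPoly_ne_zero {P : F[X]} (hP : P ≠ 0) : ofPoly P ≠ 0 := fun h =>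
  hP (ofPoly_injective (h.trans (map_zero _).symm))

theorem order_ofPoly {P : F[X]} (hP : P ≠ 0) : (ofPoly P).order = -(P.natDegree : ℤ) := by
  apply le_antisymm
  · apply HahnSeries.order_le_of_coeff_ne_zero
    rw [ofPoly_coeff, if_pos (by omega)]
    simpa using hP
  · rw [HahnSeries.le_order_iff_forall (ofPoly_ne_zero hP)]
    intro m hm
    rw [ofPoly_coeff]
    split_ifs with h
    · exact coeff_eq_zero_of_natDegree_lt (by omega)
    · rfl

theorem fract_coeff (x : Series F) (m : ℤ) :
    (fract x).coeff m = if 0 < m then x.coeff m else 0 := rfl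

theorem fract_add (x y : Series F) : fract (x + y) = fract x + fract y := by
  ext m
  rw [HahnSeries.coeff_add, fract_coeff, fract_coeff, fract_coeff]
  split_ifs <;> simp

theorem fract_ofPoly (P : F[X]) : fract (ofPoly P) = 0 := by
  ext m
  rw [fract_coeff, ofPoly_coeff]
  split_ifs <;> first | rfl | omega

theorem fract_eq_self {x : Series F} (hx : 0 < x.order) : fract x = x := by
  ext m
  rw [fract_coeff]
  split_ifs with h
  · rfl
  · exact (HahnSeries.coeff_eq_zero_of_lt_order (by omega)).symm

theorem order_fract_pos {x : Series F} (hx : fract x ≠ 0) : 0 < (fract x).order := by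
  rw [← Int.add_one_le_iff, zero_add, HahnSeries.le_order_iff_forall hx]
  intro m hm
  rw [fract_coeff, if_neg (by omega)]

theorem polyPart_coeff (x : Series F) (i : ℕ) : (polyPart x).coeff i = x.coeff (-(i : ℤ)) := by
  rw [polyPart, finsetSum_coeff]
  simp only [coeff_monomial]
  rw [Finset.sum_ite_eq' (Finset.range _) i]
  split_ifs with h
  · rfl
  · rw [Finset.mem_range, deg] at h
    exact (HahnSeries.coeff_eq_zero_of_lt_order (by omega)).symm

theorem ofPoly_polyPart_add_fract (x : Series F) : ofPoly (polyPart x) + fract x = x := by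
  ext m
  rw [HahnSeries.coeff_add, ofPoly_coeff, fract_coeff, polyPart_coeff]
  split_ifs with h h' h'
  · omega
  · rw [add_zero]
    congr 1
    omega
  · rw [zero_add]
  · omega

theorem natDegree_polyPart {x : Series F} (hx : x ≠ 0) (h : x.order ≤ 0) :
    ((polyPart x).natDegree : ℤ) = -x.order := by
  have : (polyPart x).natDegree = (-x.order).toNat := by
    apply natDegree_eq_of_le_of_coeff_ne_zero
    · rw [natDegree_le_iff_coeff_eq_zero]
      intro i hi
      rw [polyPart_coeff]
      exact HahnSeries.coeff_eq_zero_of_lt_order (by omega)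
    · rw [polyPart_coeff, Int.toNat_of_nonneg (by omega), neg_neg]
      exact HahnSeries.coeff_order_eq_zero.not.mpr hx
  omega

theorem IsIrrational.fract_ne_zero {x : Series F} (hx : IsIrrational x) : fract x ≠ 0 := by
  intro h
  apply hx (polyPart x) 1 one_ne_zero
  rw [map_one, div_one]
  conv_lhs => rw [← ofPoly_polyPart_add_fract x, h, add_zero]

theorem IsIrrational.inv_fract {x : Series F} (hx : IsIrrational x) :
    IsIrrational (fract x)⁻¹ := by
  intro P Q hQ h
  have h0 := hx.fract_ne_zero
  have hP : P ≠ 0 := by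
    rintro rfl
    rw [map_zero, zero_div] at h
    exact inv_ne_zero h0 h
  apply hx (polyPart x * P + Q) P hP
  have h1 : fract x = ofPoly Q / ofPoly P := by rw [← inv_inv (fract x), h, inv_div]
  conv_lhs => rw [← ofPoly_polyPart_add_fract x, h1]
  have := ofPoly_ne_zero hP
  rw [map_add, map_mul]
  field_simp

theorem order_inv {x : Series F} (hx : x ≠ 0) : x⁻¹.order = -x.order := by
  have h := HahnSeries.order_mul hx (inv_ne_zero hx)
  rw [mul_inv_cancel₀ hx, HahnSeries.order_one] at h
  omega

variable {f : Series F}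

theorem isIrrational_completeQuot (hf : IsIrrational f) : ∀ k, IsIrrational (completeQuot f k)
  | 0 => hf
  | k + 1 => (isIrrational_completeQuot hf k).inv_fract

theorem completeQuot_succ_ne_zero (hf : IsIrrational f) (k : ℕ) : completeQuot f (k + 1) ≠ 0 :=
  inv_ne_zero (isIrrational_completeQuot hf k).fract_ne_zero

theorem order_completeQuot_succ_neg (hf : IsIrrational f) (k : ℕ) :
    (completeQuot f (k + 1)).order < 0 := by
  have h := (isIrrational_completeQuot hf k).fract_ne_zero
  have := order_fract_pos h
  rw [completeQuot, order_inv h]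
  omega

theorem natDegree_partialQuot_succ (hf : IsIrrational f) (k : ℕ) :
    ((partialQuot f (k + 1)).natDegree : ℤ) = -(completeQuot f (k + 1)).order :=
  natDegree_polyPart (completeQuot_succ_ne_zero hf k) (order_completeQuot_succ_neg hf k).le

theorem natDegree_partialQuot_succ_pos (hf : IsIrrational f) (k : ℕ) :
    0 < (partialQuot f (k + 1)).natDegree := by
  have h1 := natDegree_partialQuot_succ hf k
  have h2 := order_completeQuot_succ_neg hf k
  omega

theorem convDeg_zero : convDeg f 0 = 0 := natDegree_one

/-- The two claims feed each other in the induction: the degree recursion makes `Q_{k+1}` of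
positive degree, hence nonzero, and this nonvanishing gives the degree of the leading product in the
next step. -/
theorem convDen_ne_zero_and_convDeg_succ (hf : IsIrrational f) (k : ℕ) :
    convDen f k ≠ 0 ∧ convDeg f (k + 1) = (partialQuot f (k + 1)).natDegree + convDeg f k := by
  induction k with
  | zero => exact ⟨one_ne_zero, by rw [convDeg_zero]; rfl⟩
  | succ k ih =>
    have hp := natDegree_partialQuot_succ_pos hf k
    have hp' := natDegree_partialQuot_succ_pos hf (k + 1)
    have hk : convDeg f k < convDeg f (k + 1) := by omega
    have h0 : convDen f (k + 1) ≠ 0 := by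
      intro h
      rw [convDeg, convDeg, h, natDegree_zero] at hk
      omega
    refine ⟨h0, ?_⟩
    have h1 : partialQuot f (k + 2) ≠ 0 := by
      intro h
      rw [h, natDegree_zero] at hp'
      omega
    have hm : (partialQuot f (k + 2) * convDen f (k + 1)).natDegree =
        (partialQuot f (k + 2)).natDegree + convDeg f (k + 1) := natDegree_mul h1 h0
    rw [convDeg, convDen, natDegree_add_eq_left_of_natDegree_lt, hm]
    rw [hm]
    exact hk.trans_le (Nat.le_add_left _ _)

theorem convDen_ne_zero (hf : IsIrrational f) (k : ℕ) : convDen f k ≠ 0 :=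
  (convDen_ne_zero_and_convDeg_succ hf k).1

theorem convDeg_succ (hf : IsIrrational f) (k : ℕ) :
    convDeg f (k + 1) = (partialQuot f (k + 1)).natDegree + convDeg f k :=
  (convDen_ne_zero_and_convDeg_succ hf k).2

theorem strictMono_convDeg (hf : IsIrrational f) : StrictMono (convDeg f) :=
  strictMono_nat_of_lt_succ fun k => by
    have h1 := convDeg_succ hf k
    have h2 := natDegree_partialQuot_succ_pos hf k
    omega

/-- The remainders `Qₖ f - Pₖ` of the continued fraction expansion. -/
def convRem (f : Series F) (k : ℕ) : Series F := ofPoly (convDen f k) * f - ofPoly (convNum f k)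

theorem convRem_zero : convRem f 0 = fract f := by
  rw [convRem, convDen, convNum, map_one, one_mul, sub_eq_iff_eq_add, add_comm]
  exact (ofPoly_polyPart_add_fract f).symm

theorem completeQuot_succ_mul_fract (hf : IsIrrational f) (k : ℕ) :
    completeQuot f (k + 1) * fract (completeQuot f k) = 1 :=
  inv_mul_cancel₀ (isIrrational_completeQuot hf k).fract_ne_zero

/-- The remainders satisfy the same recursion as the convergents. Each complete quotient has order
minus the degree of its partial quotient, so this relation yields the exact order of every remainder
by induction. -/
theorem convRem_eq (hf : IsIrrational f) (k : ℕ) :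
    convRem f k = -(completeQuot f (k + 2) * convRem f (k + 1)) := by
  induction k with
  | zero =>
    have h0 := completeQuot_succ_mul_fract hf 0
    have h1 := completeQuot_succ_mul_fract hf 1
    have h2 : ofPoly (partialQuot f 1) + fract (completeQuot f 1) = completeQuot f 1 :=
      ofPoly_polyPart_add_fract _
    have h3 : convRem f 1 = ofPoly (partialQuot f 1) * convRem f 0 - 1 := by
      rw [convRem, convRem, convDen, convNum, convDen, convNum]
      simp only [map_add, map_mul, map_one]
      ring
    have h4 : convRem f 0 = fract (completeQuot f 0) := convRem_zero
    rw [h3, h4]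
    linear_combination completeQuot f 2 * h0 + completeQuot f 2 * fract (completeQuot f 0) * h2 -
      fract (completeQuot f 0) * h1
  | succ k ih =>
    have h1 := completeQuot_succ_mul_fract hf (k + 2)
    have h2 : ofPoly (partialQuot f (k + 2)) + fract (completeQuot f (k + 2)) =
      completeQuot f (k + 2) := ofPoly_polyPart_add_fract _
    have h3 : convRem f (k + 2) =
        ofPoly (partialQuot f (k + 2)) * convRem f (k + 1) + convRem f k := by
      rw [convRem, convRem, convRem, convDen, convNum]
      simp only [map_add, map_mul]
      ring
    rw [h3, ih]
    linear_combination completeQuot f (k + 3) * convRem f (k + 1) * h2 - convRem f (k + 1) * h1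

theorem order_convRem (hf : IsIrrational f) (k : ℕ) :
    convRem f k ≠ 0 ∧ (convRem f k).order = convDeg f (k + 1) := by
  induction k with
  | zero =>
    have h := hf.fract_ne_zero
    have h1 := natDegree_partialQuot_succ hf 0
    have h2 : (completeQuot f (0 + 1)).order = -(fract f).order := order_inv h
    rw [convRem_zero, convDeg_succ hf, convDeg_zero]
    exact ⟨h, (h1.trans (by rw [h2, neg_neg])).symm⟩
  | succ k ih =>
    have h := convRem_eq hf k
    have h0 : convRem f (k + 1) ≠ 0 := by
      intro h'
      rw [h', mul_zero, neg_zero] at h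
      exact ih.1 h
    refine ⟨h0, ?_⟩
    have h1 := natDegree_partialQuot_succ hf (k + 1)
    have h2 := HahnSeries.order_mul (completeQuot_succ_ne_zero hf (k + 1)) h0
    have h3 := ih.2
    rw [h, HahnSeries.order_neg, h2] at h3
    rw [convDeg_succ hf (k + 1)]
    push_cast
    linarith

/-- Modulo polynomials, `A Q_k f` equals `A` times the remainder `Q_k f - P_k`. The degree bound
makes this product of positive order, so it is its own fractional part. -/
theorem fract_ofPoly_mul_convDen_mul (hf : IsIrrational f) {k : ℕ} {A : F[X]} (hA : A ≠ 0)
    (hd : A.natDegree < convDeg f (k + 1)) :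
    fract (ofPoly (A * convDen f k) * f) ≠ 0 ∧
      (fract (ofPoly (A * convDen f k) * f)).order = convDeg f (k + 1) - A.natDegree := by
  have h1 : ofPoly (A * convDen f k) * f = ofPoly (A * convNum f k) + ofPoly A * convRem f k := by
    rw [convRem, map_mul, map_mul]
    ring
  obtain ⟨h0, h2⟩ := order_convRem hf k
  have h3 := HahnSeries.order_mul (ofPoly_ne_zero hA) h0
  rw [h2, order_ofPoly hA] at h3
  rw [h1, fract_add, fract_ofPoly, zero_add, fract_eq_self (by omega)]
  exact ⟨mul_ne_zero (ofPoly_ne_zero hA) h0, by omega⟩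

end ContinuedFraction

/-! ### Balls of the unit ball as cosets fixing finitely many coefficients, and their measure. -/

section Cylinders

variable {F : Type*} [Field F] [Finite F]

theorem UnitBall.coeff_of_nonpos (g : UnitBall F) {m : ℤ} (hm : m ≤ 0) : g.val.coeff m = 0 :=
  absVal_lt_one_iff.mp g.2 m (by omega)

variable (F) in
/-- The first `l` coefficients of an element of `𝕃`. -/
def coords (l : ℕ) : UnitBall F →+ (Fin l → F) where
  toFun g i := g.val.coeff ((i : ℕ) + 1 : ℤ)
  map_zero' := rfl
  map_add' _ _ := rfl

theorem coords_eq_iff {l : ℕ} {g h : UnitBall F} :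
    coords F l g = coords F l h ↔ ∀ m : ℤ, m ≤ l → g.val.coeff m = h.val.coeff m := by
  constructor
  · intro e m hm
    rcases le_or_gt m 0 with h0 | h0
    · rw [g.coeff_of_nonpos h0, h.coeff_of_nonpos h0]
    · have h1 : g.val.coeff (((m - 1).toNat : ℕ) + 1 : ℤ) =
          h.val.coeff (((m - 1).toNat : ℕ) + 1 : ℤ) :=
        congrFun e ⟨(m - 1).toNat, by omega⟩
      rwa [show (((m - 1).toNat : ℕ) + 1 : ℤ) = m by omega] at h1
  · intro e
    funext i
    exact e _ (by have := i.2; omega)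

theorem coords_eq_zero_iff {l : ℕ} {g : UnitBall F} :
    coords F l g = 0 ↔ ∀ m : ℤ, m ≤ l → g.val.coeff m = 0 := by
  rw [← map_zero (coords F l), coords_eq_iff]
  rfl

theorem coords_eq_of_le {l l' : ℕ} (hl : l ≤ l') {g h : UnitBall F}
    (e : coords F l' g = coords F l' h) : coords F l g = coords F l h := by
  rw [coords_eq_iff] at e ⊢
  exact fun m hm => e m (by omega)

theorem coords_eq_zero_iff_of_order {l : ℕ} {g : UnitBall F} (hg : g.val ≠ 0) :
    coords F l g = 0 ↔ (l : ℤ) < g.val.order := by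
  rw [coords_eq_zero_iff, ← Int.add_one_le_iff, HahnSeries.le_order_iff_forall hg]
  simp only [Int.lt_add_one_iff]

/-- The norm takes only the values `0` and integral powers of `q`, so `< q^(-l)` is the same as `≤
q^(-(l+1))`. -/
theorem absVal_sub_lt_iff {l : ℕ} {g h : UnitBall F} :
    absVal (g.val - h.val) < 1 / (Nat.card F : ℝ) ^ l ↔ coords F l g = coords F l h := by
  have hq := one_lt_q F
  have hq0 : (0 : ℝ) < Nat.card F := by linarith
  have h1 : absVal (g.val - h.val) < 1 / (Nat.card F : ℝ) ^ l ↔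
      absVal (g.val - h.val) ≤ (Nat.card F : ℝ) ^ (-((l : ℤ) + 1)) := by
    rw [one_div, ← zpow_natCast, ← zpow_neg]
    by_cases h0 : g.val - h.val = 0
    · rw [h0, absVal_zero]
      exact iff_of_true (zpow_pos hq0 _) (zpow_pos hq0 _).le
    · rw [absVal, if_neg h0, zpow_lt_zpow_iff_right₀ hq, zpow_le_zpow_iff_right₀ hq]
      omega
  rw [h1, absVal_le_zpow_iff, coords_eq_iff]
  simp only [Int.lt_add_one_iff, HahnSeries.coeff_sub, sub_eq_zero]

theorem coords_surjective (l : ℕ) : Function.Surjective (coords F l) := by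
  intro v
  let a : ℕ → F := fun i => if h : i < l then v ⟨i, h⟩ else 0
  refine ⟨UnitBall.mk a, funext fun i => ?_⟩
  change (UnitBall.mk a).val.coeff ((i : ℕ) + 1 : ℤ) = v i
  rw [UnitBall.mk_coeff, if_pos (by omega)]
  simp [a]

/-- The ball of all `g` with the same first `l` coefficients as `u`. -/
def cyl (u : UnitBall F) (l : ℕ) : Set (UnitBall F) := {g | coords F l u = coords F l g}

theorem mem_cyl {u g : UnitBall F} {l : ℕ} : g ∈ cyl u l ↔ coords F l u = coords F l g := Iff.rfl

theorem cyl_eq_ball (u : UnitBall F) (l : ℕ) :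
    cyl u l = Metric.ball u (1 / (Nat.card F : ℝ) ^ l) := by
  ext g
  rw [mem_cyl, Metric.mem_ball', dist_eq, absVal_sub_lt_iff]

theorem measurableSet_cyl (u : UnitBall F) (l : ℕ) : MeasurableSet (cyl u l) := by
  rw [cyl_eq_ball]
  exact measurableSet_ball

theorem cyl_zero (l : ℕ) : cyl (0 : UnitBall F) l = (coords F l).ker := by
  ext g
  rw [mem_cyl, map_zero, eq_comm]
  rfl

/-- This ball is a subgroup of index `q^l`, and its cosets have equal measure. -/
theorem haar_cyl_zero (l : ℕ) :
    haar F (cyl 0 l) = ((Nat.card F : ENNReal) ^ l)⁻¹ := by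
  have hi : (coords F l).ker.index = Nat.card F ^ l := by
    rw [AddSubgroup.index_ker, AddMonoidHom.range_eq_top.mpr (coords_surjective l)]
    simp [Nat.card_fun]
  have hq : Nat.card F ^ l ≠ 0 := pow_ne_zero _ Nat.card_pos.ne'
  have : (coords F l).ker.FiniteIndex := ⟨by rw [hi]; exact hq⟩
  have h := AddSubgroup.index_mul_measure (coords F l).ker
    (by rw [← cyl_zero]; exact measurableSet_cyl _ _) (haar F)
  rw [hi, ← cyl_zero, measure_univ, mul_comm] at h
  rw [ENNReal.eq_inv_of_mul_eq_one_left h]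
  push_cast
  rfl

theorem haar_cyl (u : UnitBall F) (l : ℕ) :
    haar F (cyl u l) = ((Nat.card F : ENNReal) ^ l)⁻¹ := by
  rw [← haar_cyl_zero, ← measure_preimage_add (haar F) u (cyl u l)]
  congr 1
  ext g
  rw [Set.mem_preimage, mem_cyl, mem_cyl, map_add, map_zero, left_eq_add, eq_comm]

theorem haar_real_cyl (u : UnitBall F) (l : ℕ) :
    (haar F).real (cyl u l) = ((Nat.card F : ℝ) ^ l)⁻¹ := by
  rw [measureReal_def, haar_cyl]
  simp

theorem cyl_inter_cyl_of_eq {u v : UnitBall F} {l l' : ℕ} (hl : l ≤ l')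
    (h : coords F l u = coords F l v) : cyl u l ∩ cyl v l' = cyl v l' :=
  Set.inter_eq_right.mpr fun _ hg => h.trans (coords_eq_of_le hl hg)

theorem cyl_inter_cyl_of_ne {u v : UnitBall F} {l l' : ℕ} (hl : l ≤ l')
    (h : coords F l u ≠ coords F l v) : cyl u l ∩ cyl v l' = ∅ :=
  Set.eq_empty_of_forall_notMem fun _ hg =>
    h (hg.1.trans (coords_eq_of_le hl hg.2).symm)

end Cylinders

/-! ### Counting polynomials by degree. -/

section Polynomials

variable (F : Type*) [Field F] [Finite F]

theorem finite_degree_lt (n : ℕ) : {Q : F[X] | Q.degree < n}.Finite := by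
  have : Finite (degreeLT F n) := Finite.of_equiv _ (degreeLTEquiv F n).toEquiv.symm
  refine (Set.toFinite (degreeLT F n : Set F[X])).subset fun Q hQ => ?_
  exact mem_degreeLT.mpr hQ

/-- The polynomials of degree less than `n`. -/
def polyLT (n : ℕ) : Finset F[X] := (finite_degree_lt F n).toFinset

variable {F} in
theorem mem_polyLT {n : ℕ} {Q : F[X]} : Q ∈ polyLT F n ↔ Q.degree < n := by simp [polyLT]

theorem card_polyLT (n : ℕ) : (polyLT F n).card = Nat.card F ^ n := by
  have h : Nat.card (degreeLT F n) = Nat.card F ^ n := by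
    rw [Nat.card_congr (degreeLTEquiv F n).toEquiv]
    simp [Nat.card_fun]
  have hs : {Q : F[X] | Q.degree < n} = (degreeLT F n : Set F[X]) :=
    Set.ext fun Q => mem_degreeLT.symm
  rw [polyLT, ← Set.ncard_eq_toFinset_card _ (finite_degree_lt F n), hs, ← h]
  rfl

open Classical in
/-- The polynomials of degree `n`. -/
def polyEq (n : ℕ) : Finset F[X] := polyLT F (n + 1) \ polyLT F n

variable {F} in
theorem mem_polyEq {n : ℕ} {Q : F[X]} : Q ∈ polyEq F n ↔ Q.degree = n := by
  classical
  rw [polyEq, Finset.mem_sdiff, mem_polyLT, mem_polyLT]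
  by_cases hQ : Q = 0
  · simp [hQ]
  · rw [degree_eq_natDegree hQ]
    norm_cast
    omega

theorem card_polyEq (n : ℕ) : (polyEq F n).card = Nat.card F ^ (n + 1) - Nat.card F ^ n := by
  classical
  rw [polyEq, Finset.card_sdiff_of_subset, card_polyLT, card_polyLT]
  intro Q
  rw [mem_polyLT, mem_polyLT]
  exact fun h => h.trans (by exact_mod_cast n.lt_succ_self)

end Polynomials

/-! ### Distribution of the points `{Qf}`, and the blocks `[n_k, n_{k+1})`. -/

section Orbit

variable {F : Type*} [Field F] [Finite F]

/-- The homomorphism `Q ↦ {Q f}`. -/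
def orbit (f : UnitBall F) : F[X] →+ UnitBall F where
  toFun Q := ⟨fract (ofPoly Q * f.val), absVal_lt_one_iff.mpr fun _ hn => if_neg (by omega)⟩
  map_zero' := Subtype.ext <| by
    change fract (ofPoly 0 * f.val) = 0
    rw [map_zero, zero_mul, ← map_zero (ofPoly (F := F)), fract_ofPoly, map_zero]
  map_add' P Q := Subtype.ext <| by
    change fract (ofPoly (P + Q) * f.val) = fract (ofPoly P * f.val) + fract (ofPoly Q * f.val)
    rw [map_add, add_mul, fract_add]

theorem orbit_val (f : UnitBall F) (Q : F[X]) :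
    (orbit f Q).val = fract (ofPoly Q * f.val) := rfl

variable {f : UnitBall F}

theorem coords_orbit_mul_convDen_eq_zero_iff (hf : IsIrrational f.val) {k l : ℕ} {A : F[X]}
    (hA : A ≠ 0) (hd : A.natDegree < convDeg f.val (k + 1)) :
    coords F l (orbit f (A * convDen f.val k)) = 0 ↔
      l + A.natDegree < convDeg f.val (k + 1) := by
  obtain ⟨h0, h1⟩ := fract_ofPoly_mul_convDen_mul hf hA hd
  rw [coords_eq_zero_iff_of_order (g := orbit f (A * convDen f.val k)) h0, orbit_val, h1]
  omega

theorem exists_eq_mul_convDen_add (hf : IsIrrational f.val) {k n : ℕ} {Q : F[X]}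
    (hQ : Q.degree = n) (hn : convDeg f.val k ≤ n) :
    ∃ A R : F[X], Q = A * convDen f.val k + R ∧ A ≠ 0 ∧
      A.natDegree + convDeg f.val k = n ∧ R.degree < convDeg f.val k := by
  have h0 := convDen_ne_zero hf k
  have hd : (convDen f.val k).degree = convDeg f.val k := degree_eq_natDegree h0
  have h1 : (convDen f.val k).degree + (Q / convDen f.val k).degree = Q.degree :=
    degree_add_div h0 (by rw [hd, hQ]; exact_mod_cast hn)
  have hA : Q / convDen f.val k ≠ 0 := by
    intro h
    rw [h, degree_zero, hQ] at h1
    simp at h1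
  refine ⟨Q / convDen f.val k, Q % convDen f.val k, ?_, hA, ?_, ?_⟩
  · rw [mul_comm, EuclideanDomain.div_add_mod]
  · rw [hd, hQ, degree_eq_natDegree hA] at h1
    norm_cast at h1
    omega
  · rw [← hd]
    exact EuclideanDomain.mod_lt _ h0

/-- In `S = A Q_k + R`, the first `n_k` coefficients of `{A Q_k f}` vanish because `deg A + n_k = n
< n_{k+1}`. So those of `{Rf}` vanish too, `hinj` gives `R = 0`, and the order `n_{k+1} + n_k - n`
of `{A Q_k f}` must exceed `l`. The injectivity at level `k` is a hypothesis because this lemma is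
also the induction step of `eq_zero_of_coords_orbit_eq_zero`. -/
theorem add_lt_of_coords_orbit_eq_zero (hf : IsIrrational f.val) {k n l : ℕ}
    (hinj : ∀ R : F[X], R.degree < convDeg f.val k →
      coords F (convDeg f.val k) (orbit f R) = 0 → R = 0)
    (h1 : convDeg f.val k ≤ n) (h2 : n < convDeg f.val (k + 1)) (hl : convDeg f.val k ≤ l)
    {S : F[X]} (hS : S.degree = n) (h : coords F l (orbit f S) = 0) :
    n + l < convDeg f.val k + convDeg f.val (k + 1) := by
  obtain ⟨A, R, rfl, hA, hd, hR⟩ := exists_eq_mul_convDen_add hf hS h1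
  have hA' := (coords_orbit_mul_convDen_eq_zero_iff hf (l := convDeg f.val k) hA
    (k := k) (by omega)).mpr (by omega)
  have h' : coords F (convDeg f.val k) (orbit f (A * convDen f.val k + R)) = 0 := by
    rw [← map_zero (coords F _)]
    exact coords_eq_of_le hl (by rw [h, map_zero])
  rw [map_add, map_add, hA', zero_add] at h'
  obtain rfl := hinj R hR h'
  rw [add_zero, coords_orbit_mul_convDen_eq_zero_iff hf hA (by omega)] at h
  omega

theorem eq_zero_of_coords_orbit_eq_zero (hf : IsIrrational f.val) (k : ℕ) (R : F[X])
    (hR : R.degree < convDeg f.val k) (h : coords F (convDeg f.val k) (orbit f R) = 0) :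
    R = 0 := by
  induction k generalizing R with
  | zero =>
    rw [convDeg_zero] at hR
    simpa using hR
  | succ k ih =>
    by_contra h0
    have hd := degree_eq_natDegree h0
    have hlt := strictMono_convDeg hf (Nat.lt_add_one k)
    have hR' : R.natDegree < convDeg f.val (k + 1) := by
      rw [hd] at hR
      exact_mod_cast hR
    rcases lt_or_ge R.natDegree (convDeg f.val k) with hk | hk
    · refine h0 (ih R (by rw [hd]; exact_mod_cast hk) ?_)
      rw [← map_zero (coords F _)]
      exact coords_eq_of_le hlt.le (by rw [h, map_zero])
    -- With `l = n_{k+1}` the conclusion would force `deg R < n_k`.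
    · have := add_lt_of_coords_orbit_eq_zero hf ih hk hR' hlt.le hd h
      omega

/-- At level `n_k` an injective map from a finite set to itself is surjective; smaller levels follow
by truncation. -/
theorem exists_coords_orbit_eq (hf : IsIrrational f.val) {k l : ℕ} (hl : l ≤ convDeg f.val k)
    (v : Fin l → F) : ∃ R : F[X], R.degree < convDeg f.val k ∧ coords F l (orbit f R) = v := by
  obtain ⟨g, rfl⟩ := coords_surjective l v
  let φ : (Fin (convDeg f.val k) → F) →+ (Fin (convDeg f.val k) → F) :=
    ((coords F _).comp (orbit f)).comp
      ((degreeLT F _).subtype.comp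
        (degreeLTEquiv F (convDeg f.val k)).symm.toLinearMap).toAddMonoidHom
  have hφ : Function.Injective φ := by
    rw [injective_iff_map_eq_zero]
    intro w hw
    have h := eq_zero_of_coords_orbit_eq_zero hf k _
      (mem_degreeLT.mp ((degreeLTEquiv F (convDeg f.val k)).symm w).2) hw
    exact (LinearEquiv.map_eq_zero_iff _).mp (Subtype.ext h)
  obtain ⟨w, hw⟩ := Finite.surjective_of_injective hφ (coords F _ g)
  exact ⟨_, mem_degreeLT.mp ((degreeLTEquiv F (convDeg f.val k)).symm w).2, coords_eq_of_le hl hw⟩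

-- Adding a polynomial of degree `< n_k ≤ n` keeps the degree `n` and can move the first `l`
-- coefficients to any prescribed value. All fibres therefore have the same size.
open Classical in
theorem card_filter_coords_orbit_mul (hf : IsIrrational f.val) {k l n : ℕ}
    (hl : l ≤ convDeg f.val k) (hn : convDeg f.val k ≤ n) (v : Fin l → F) :
    ((polyEq F n).filter fun Q => coords F l (orbit f Q) = v).card * Nat.card F ^ l =
      (polyEq F n).card := by
  have : Fintype F := Fintype.ofFinite F
  have hfib : ∀ w : Fin l → F, ((polyEq F n).filter fun Q => coords F l (orbit f Q) = w).card =
      ((polyEq F n).filter fun Q => coords F l (orbit f Q) = v).card := by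
    intro w
    obtain ⟨R, hR, hRv⟩ := exists_coords_orbit_eq hf hl (v - w)
    have hRn : R.degree < n := hR.trans_le (by exact_mod_cast hn)
    refine Finset.card_nbij' (· + R) (· - R) ?_ ?_ ?_ ?_
    · intro Q hQ
      simp only [Finset.coe_filter, Set.mem_ofPred_eq, mem_polyEq] at hQ ⊢
      refine ⟨by rw [degree_add_eq_left_of_degree_lt (by rwa [hQ.1]), hQ.1], ?_⟩
      rw [map_add, map_add, hQ.2, hRv]
      abel
    · intro Q hQ
      simp only [Finset.coe_filter, Set.mem_ofPred_eq, mem_polyEq] at hQ ⊢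
      refine ⟨by rw [degree_sub_eq_left_of_degree_lt (by rwa [hQ.1]), hQ.1], ?_⟩
      rw [map_sub, map_sub, hQ.2, hRv]
      abel
    · exact fun Q _ => add_sub_cancel_right Q R
    · exact fun Q _ => sub_add_cancel Q R
  rw [Finset.card_eq_sum_card_fiberwise (s := polyEq F n) (f := fun Q => coords F l (orbit f Q))
    (t := Finset.univ) (fun _ _ => Finset.mem_coe.mpr (Finset.mem_univ _))]
  simp only [hfib, Finset.sum_const, smul_eq_mul, mul_comm, Finset.card_univ, Fintype.card_fun,
    Fintype.card_fin, Nat.card_eq_fintype_card]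

/-- Every natural number lies in one of the intervals `[nₖ, nₖ₊₁)`. -/
theorem exists_convDeg_le_lt (hf : IsIrrational f.val) (n : ℕ) :
    ∃ k, convDeg f.val k ≤ n ∧ n < convDeg f.val (k + 1) := by
  have hm := strictMono_convDeg hf
  have hex : ∃ j, n < convDeg f.val j := ⟨n + 1, hm.le_apply (x := n + 1)⟩
  classical
  obtain ⟨k, hk⟩ : ∃ k, Nat.find hex = k + 1 := by
    refine Nat.exists_eq_succ_of_ne_zero fun h => ?_
    have := Nat.find_spec hex
    rw [h, convDeg_zero] at this
    omega
  refine ⟨k, not_lt.mp (Nat.find_min hex (by omega)), ?_⟩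
  rw [← hk]
  exact Nat.find_spec hex

open Classical in
/-- The index `k` with `nₖ ≤ n < nₖ₊₁`. -/
def blockIdx (f : UnitBall F) (n : ℕ) : ℕ :=
  if h : ∃ k, convDeg f.val k ≤ n ∧ n < convDeg f.val (k + 1) then h.choose else 0

theorem convDeg_blockIdx_le (hf : IsIrrational f.val) (n : ℕ) :
    convDeg f.val (blockIdx f n) ≤ n := by
  rw [blockIdx, dif_pos (exists_convDeg_le_lt hf n)]
  exact (exists_convDeg_le_lt hf n).choose_spec.1

theorem lt_convDeg_blockIdx_succ (hf : IsIrrational f.val) (n : ℕ) :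
    n < convDeg f.val (blockIdx f n + 1) := by
  rw [blockIdx, dif_pos (exists_convDeg_le_lt hf n)]
  exact (exists_convDeg_le_lt hf n).choose_spec.2

theorem blockIdx_eq (hf : IsIrrational f.val) {k n : ℕ} (h1 : convDeg f.val k ≤ n)
    (h2 : n < convDeg f.val (k + 1)) : blockIdx f n = k := by
  have hm := strictMono_convDeg hf
  have h3 := hm.lt_iff_lt.mp (h1.trans_lt (lt_convDeg_blockIdx_succ hf n))
  have h4 := hm.lt_iff_lt.mp ((convDeg_blockIdx_le hf n).trans_lt h2)
  omega

theorem monotone_blockIdx (hf : IsIrrational f.val) : Monotone (blockIdx f) := by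
  intro m n hmn
  have := (strictMono_convDeg hf).lt_iff_lt.mp
    (((convDeg_blockIdx_le hf m).trans hmn).trans_lt (lt_convDeg_blockIdx_succ hf n))
  omega

end Orbit

/-! ### A second-moment form of the second Borel–Cantelli lemma. -/

section SecondMoment

open Filter

variable {Ω ι : Type*} [MeasurableSpace Ω] {μ : Measure Ω} [IsProbabilityMeasure μ]
  {A : ι → Set Ω}

theorem integral_sum_indicator (hA : ∀ i, MeasurableSet (A i)) (s : Finset ι) :
    ∫ x, ∑ i ∈ s, (A i).indicator (1 : Ω → ℝ) x ∂μ = ∑ i ∈ s, μ.real (A i) := by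
  have hi : ∀ i ∈ s, Integrable ((A i).indicator (1 : Ω → ℝ)) μ := fun i _ =>
    (integrable_const (1 : ℝ)).indicator (hA i)
  rw [integral_finsetSum _ hi]
  exact Finset.sum_congr rfl fun i _ => integral_indicator_one (hA i)

theorem integral_sum_indicator_sq (hA : ∀ i, MeasurableSet (A i)) (s : Finset ι) :
    ∫ x, (∑ i ∈ s, (A i).indicator (1 : Ω → ℝ) x) ^ 2 ∂μ =
      ∑ i ∈ s, ∑ j ∈ s, μ.real (A i ∩ A j) := by
  have h : ∀ x, (∑ i ∈ s, (A i).indicator (1 : Ω → ℝ) x) ^ 2 =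
      ∑ p ∈ s ×ˢ s, (A p.1 ∩ A p.2).indicator (1 : Ω → ℝ) x := by
    intro x
    rw [sq, Finset.sum_mul_sum, Finset.sum_product]
    refine Finset.sum_congr rfl fun i _ => Finset.sum_congr rfl fun j _ => ?_
    rw [Set.inter_indicator_one]
    rfl
  simp_rw [h]
  rw [integral_sum_indicator (A := fun p : ι × ι => A p.1 ∩ A p.2)
    (fun p => (hA p.1).inter (hA p.2)), Finset.sum_product]

/-- Chebyshev's inequality for the number `S` of events, of mean `E`: since `M ≤ E`, the event `S ≤
M` forces `(S - E)² ≥ (E - M)²`. -/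
theorem sq_mul_measureReal_le (hA : ∀ i, MeasurableSet (A i)) (s : Finset ι) {C M : ℝ}
    (h2 : ∑ i ∈ s, ∑ j ∈ s, μ.real (A i ∩ A j) ≤
      (∑ i ∈ s, μ.real (A i)) ^ 2 + C * ∑ i ∈ s, μ.real (A i))
    (hM : M ≤ ∑ i ∈ s, μ.real (A i)) :
    (∑ i ∈ s, μ.real (A i) - M) ^ 2 *
        μ.real {x | ∑ i ∈ s, (A i).indicator (1 : Ω → ℝ) x ≤ M} ≤
      C * ∑ i ∈ s, μ.real (A i) := by
  set E := ∑ i ∈ s, μ.real (A i) with hE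
  set S : Ω → ℝ := fun x => ∑ i ∈ s, (A i).indicator (1 : Ω → ℝ) x with hS
  have hSm : Measurable S :=
    Finset.measurable_fun_sum s fun i _ => measurable_one.indicator (hA i)
  have hSb : ∀ x, ‖S x‖ ≤ s.card := by
    intro x
    refine (norm_sum_le _ _).trans ?_
    rw [Finset.cast_card]
    refine Finset.sum_le_sum fun i _ => ?_
    by_cases hx : x ∈ A i <;> simp [hx]
  have hi1 : Integrable S μ := Integrable.of_bound hSm.aestronglyMeasurable _ (ae_of_all _ hSb)
  have hi2 : Integrable (fun x => S x ^ 2) μ := by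
    refine Integrable.of_bound (hSm.pow_const 2).aestronglyMeasurable ((s.card : ℝ) ^ 2)
      (ae_of_all _ fun x => ?_)
    rw [norm_pow]
    exact pow_le_pow_left₀ (norm_nonneg _) (hSb x) 2
  have hsq : (fun x => (S x - E) ^ 2) = fun x => S x ^ 2 - 2 * E * S x + E ^ 2 := by
    funext x
    ring
  have hi3 : Integrable (fun x => S x ^ 2 - 2 * E * S x) μ := hi2.sub (hi1.const_mul _)
  have hi : Integrable (fun x => (S x - E) ^ 2) μ := by
    rw [hsq]
    exact hi3.add (integrable_const _)
  have hint : ∫ x, (S x - E) ^ 2 ∂μ =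
      ∑ i ∈ s, ∑ j ∈ s, μ.real (A i ∩ A j) - E ^ 2 := by
    rw [hsq, integral_add hi3 (integrable_const _), integral_sub hi2 (hi1.const_mul _),
      integral_const_mul, integral_sum_indicator_sq hA s, integral_sum_indicator hA s, ← hE,
      integral_const, probReal_univ, one_smul]
    ring
  have hmarkov := mul_meas_ge_le_integral_of_nonneg
    (ae_of_all μ fun x => sq_nonneg (S x - E)) hi ((E - M) ^ 2)
  have hmono : μ.real {x | S x ≤ M} ≤ μ.real {x | (E - M) ^ 2 ≤ (S x - E) ^ 2} := by
    refine measureReal_mono fun x hx => ?_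
    change S x ≤ M at hx
    change (E - M) ^ 2 ≤ (S x - E) ^ 2
    nlinarith
  calc (E - M) ^ 2 * μ.real {x | S x ≤ M}
      ≤ (E - M) ^ 2 * μ.real {x | (E - M) ^ 2 ≤ (S x - E) ^ 2} :=
        mul_le_mul_of_nonneg_left hmono (sq_nonneg _)
    _ ≤ ∫ x, (S x - E) ^ 2 ∂μ := hmarkov
    _ ≤ C * E := by
      rw [hint]
      linarith

/-- A second Borel-Cantelli lemma: if the variance of the number of events that occur is at most
a constant times its mean, and the mean tends to infinity, then almost surely infinitely many
events occur. -/
theorem ae_infinite_of_second_moment (hA : ∀ i, MeasurableSet (A i)) (s : ℕ → Finset ι) {C : ℝ}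
    (h2 : ∀ N, ∑ i ∈ s N, ∑ j ∈ s N, μ.real (A i ∩ A j) ≤
      (∑ i ∈ s N, μ.real (A i)) ^ 2 + C * ∑ i ∈ s N, μ.real (A i))
    (hdiv : Tendsto (fun N => ∑ i ∈ s N, μ.real (A i)) atTop atTop) :
    ∀ᵐ x ∂μ, {i | x ∈ A i}.Infinite := by
  have hnull : ∀ M : ℕ, μ {x | ∀ N, ∑ i ∈ s N, (A i).indicator (1 : Ω → ℝ) x ≤ M} = 0 := by
    intro M
    set Z := {x | ∀ N, ∑ i ∈ s N, (A i).indicator (1 : Ω → ℝ) x ≤ M}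
    rw [← measureReal_eq_zero_iff]
    by_contra hne
    have hr : 0 < μ.real Z := lt_of_le_of_ne measureReal_nonneg (Ne.symm hne)
    -- The first threshold gives `E > 0` and `E - M ≥ E / 2`. Chebyshev then yields `E * μ.real Z ≤
    -- 4 * C`, which the second threshold contradicts.
    obtain ⟨N, h1, h3⟩ := ((hdiv.eventually_ge_atTop (2 * M + 1 : ℝ)).and
      (hdiv.eventually_gt_atTop (4 * C / μ.real Z))).exists
    have hM0 : (0 : ℝ) ≤ M := Nat.cast_nonneg M
    have h4 := sq_mul_measureReal_le hA (s N) (M := M) (h2 N) (by linarith)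
    set E := ∑ i ∈ s N, μ.real (A i)
    have h5 : μ.real Z ≤ μ.real {x | ∑ i ∈ s N, (A i).indicator (1 : Ω → ℝ) x ≤ M} :=
      measureReal_mono fun x hx => hx N
    have h6 : (E / 2) ^ 2 * μ.real Z ≤ C * E := by
      refine le_trans ?_ h4
      gcongr
      linarith
    rw [div_lt_iff₀ hr] at h3
    nlinarith
  filter_upwards [ae_all_iff.mpr fun M => measure_eq_zero_iff_ae_notMem.mp (hnull M)] with x hx hfin
  refine hx hfin.toFinset.card fun N => ?_
  classical
  simp only [Set.indicator_apply, Pi.one_apply, Finset.sum_boole]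
  exact_mod_cast Finset.card_le_card fun i hi => by simpa using (Finset.mem_filter.mp hi).2

end SecondMoment

/-! ### The divergence case: almost independence of the balls. -/

section Divergence

open Filter

variable {F : Type*} [Field F] [Finite F]

theorem cast_card_polyEq (n : ℕ) :
    ((polyEq F n).card : ℝ) = (Nat.card F : ℝ) ^ (n + 1) - (Nat.card F : ℝ) ^ n := by
  rw [card_polyEq, Nat.cast_sub (Nat.pow_le_pow_right Nat.card_pos n.le_succ)]
  push_cast
  rfl

theorem pow_le_card_polyEq (n : ℕ) : (Nat.card F : ℝ) ^ n ≤ (polyEq F n).card := by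
  have h2 : (2 : ℝ) ≤ Nat.card F := by exact_mod_cast Finite.one_lt_card (α := F)
  have h3 : (0 : ℝ) ≤ (Nat.card F : ℝ) ^ n := by positivity
  rw [cast_card_polyEq, pow_succ]
  nlinarith

variable (F) in
/-- The sum of the measures of the balls `cyl u (L n)` around the points `u = {Q f}` with
`deg Q = n`. -/
def mass (L : ℕ → ℕ) (n : ℕ) : ℝ := (polyEq F n).card * ((Nat.card F : ℝ) ^ L n)⁻¹

theorem mass_nonneg (L : ℕ → ℕ) (n : ℕ) : 0 ≤ mass F L n := by
  unfold mass
  positivity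

/-- The sum of the measures of the intersections of the balls around `{P f}` and `{Q f}` with
`deg P = m` and `deg Q = n`. -/
def pairMass (f : UnitBall F) (L : ℕ → ℕ) (m n : ℕ) : ℝ :=
  ∑ P ∈ polyEq F m, ∑ Q ∈ polyEq F n,
    (haar F).real (cyl (orbit f P) (L m) ∩ cyl (orbit f Q) (L n))

theorem pairMass_comm (f : UnitBall F) (L : ℕ → ℕ) (m n : ℕ) :
    pairMass f L m n = pairMass f L n m := by
  rw [pairMass, pairMass, Finset.sum_comm]
  simp only [Set.inter_comm]

/-- A bound for the failure of the pairwise independence of the balls around `{P f}` and `{Q f}`,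
where `deg P = m` and `deg Q = n`, relative to `mass F L m`. -/
def excess (f : UnitBall F) (L : ℕ → ℕ) (m n : ℕ) : ℝ :=
  if n + L m < convDeg f.val (blockIdx f (L m)) + convDeg f.val (blockIdx f (L m) + 1) then
    (polyEq F n).card * ((Nat.card F : ℝ) ^
      (convDeg f.val (blockIdx f (L m)) + convDeg f.val (blockIdx f (L m) + 1) - L m))⁻¹
  else 0

theorem excess_nonneg (f : UnitBall F) (L : ℕ → ℕ) (m n : ℕ) : 0 ≤ excess f L m n := by
  unfold excess
  split_ifs <;> positivity

/-- The excess vanishes for `n ≥ c`, and the polynomials of all degrees `< c` number `q^c - 1` by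
telescoping, against the factor `q^(-c)`. -/
theorem sum_excess_le_one (f : UnitBall F) (L : ℕ → ℕ) (m N : ℕ) :
    ∑ n ∈ Finset.range N, excess f L m n ≤ 1 := by
  have hq : (0 : ℝ) < Nat.card F := by linarith [one_lt_q F]
  set c := convDeg f.val (blockIdx f (L m)) + convDeg f.val (blockIdx f (L m) + 1) - L m with hc
  have h : ∀ n, excess f L m n =
      if n < c then (polyEq F n).card * ((Nat.card F : ℝ) ^ c)⁻¹ else 0 := by
    intro n
    rw [excess]
    exact if_congr (by omega) rfl rfl
  simp_rw [h]
  rw [← Finset.sum_filter]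
  calc ∑ n ∈ (Finset.range N).filter (· < c), (polyEq F n).card * ((Nat.card F : ℝ) ^ c)⁻¹
      ≤ ∑ n ∈ Finset.range c, (polyEq F n).card * ((Nat.card F : ℝ) ^ c)⁻¹ := by
        refine Finset.sum_le_sum_of_subset_of_nonneg (fun n hn => ?_) fun _ _ _ => by positivity
        exact Finset.mem_range.mpr (Finset.mem_filter.mp hn).2
    _ = ((Nat.card F : ℝ) ^ c - 1) * ((Nat.card F : ℝ) ^ c)⁻¹ := by
        rw [← Finset.sum_mul]
        simp_rw [cast_card_polyEq]
        rw [Finset.sum_range_sub (fun n => (Nat.card F : ℝ) ^ n), pow_zero]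
    _ ≤ 1 := by
        rw [← div_eq_mul_inv, div_le_one (by positivity)]
        linarith

variable {f : UnitBall F} {L : ℕ → ℕ}

open Classical in
theorem sum_haar_inter_eq {m n : ℕ} (hL : L m ≤ L n) (P : F[X]) :
    ∑ Q ∈ polyEq F n, (haar F).real (cyl (orbit f P) (L m) ∩ cyl (orbit f Q) (L n)) =
      ((polyEq F n).filter fun Q =>
        coords F (L m) (orbit f Q) = coords F (L m) (orbit f P)).card *
        ((Nat.card F : ℝ) ^ L n)⁻¹ := by
  rw [← nsmul_eq_mul, ← Finset.sum_const, Finset.sum_filter]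
  refine Finset.sum_congr rfl fun Q _ => ?_
  split_ifs with h
  · rw [cyl_inter_cyl_of_eq hL h.symm, haar_real_cyl]
  · rw [cyl_inter_cyl_of_ne hL (Ne.symm h), measureReal_empty]

/-- Balls of equal degree are disjoint: the difference of two centres comes from a polynomial of
degree `< n_{k+1}`, and agreement to level `L n ≥ n_{k+1}` makes that polynomial zero. -/
theorem pairMass_self_le (hf : IsIrrational f.val)
    (hLk : ∀ n, convDeg f.val (blockIdx f n + 1) ≤ L n) (n : ℕ) :
    pairMass f L n n ≤ mass F L n := by
  classical
  rw [pairMass, mass, ← nsmul_eq_mul, ← Finset.sum_const]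
  refine Finset.sum_le_sum fun P hP => ?_
  rw [sum_haar_inter_eq le_rfl P]
  refine mul_le_of_le_one_left (by positivity) ?_
  norm_cast
  rw [Finset.card_le_one_iff_subset_singleton]
  refine ⟨P, fun Q hQ => ?_⟩
  rw [Finset.mem_filter, mem_polyEq] at hQ
  rw [mem_polyEq] at hP
  rw [Finset.mem_singleton, ← sub_eq_zero]
  refine eq_zero_of_coords_orbit_eq_zero hf (blockIdx f n + 1) _ ?_ ?_
  · refine (degree_sub_le Q P).trans_lt ?_
    rw [hQ.1, hP, max_self]
    exact_mod_cast lt_convDeg_blockIdx_succ hf n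
  · rw [map_sub, map_sub, sub_eq_zero]
    exact coords_eq_of_le (hLk n) hQ.2

open Classical in
theorem card_filter_coords_orbit_eq (hf : IsIrrational f.val) {k l n : ℕ}
    (hl : l ≤ convDeg f.val k) (hn : convDeg f.val k ≤ n) (v : Fin l → F) :
    (((polyEq F n).filter fun Q => coords F l (orbit f Q) = v).card : ℝ) =
      (polyEq F n).card * ((Nat.card F : ℝ) ^ l)⁻¹ := by
  have hq : (0 : ℝ) < Nat.card F := by linarith [one_lt_q F]
  rw [eq_mul_inv_iff_mul_eq₀ (by positivity)]
  exact_mod_cast card_filter_coords_orbit_mul hf hl hn v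

-- If `L m ≤ n_k`, with `k` the block of `n`, the fibre count is exact and there is no error. If `L
-- m > n_k`, any solution `Q` gives `Q - P` of degree `n` with `L m` vanishing coefficients, so `n +
-- L m < n_k + n_{k+1}`; this is the range where `excess` is nonzero.
open Classical in
theorem card_filter_mul_le (hf : IsIrrational f.val)
    (hLk : ∀ n, convDeg f.val (blockIdx f n + 1) ≤ L n) {m n : ℕ} (hmn : m < n) {P : F[X]}
    (hP : P.degree = m) :
    (((polyEq F n).filter fun Q =>
        coords F (L m) (orbit f Q) = coords F (L m) (orbit f P)).card : ℝ) *
        ((Nat.card F : ℝ) ^ L n)⁻¹ ≤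
      ((Nat.card F : ℝ) ^ L m)⁻¹ * (mass F L n + excess f L m n) := by
  have hq : (0 : ℝ) < Nat.card F := by linarith [one_lt_q F]
  have hk := convDeg_blockIdx_le hf n
  have hk' := lt_convDeg_blockIdx_succ hf n
  have hLn := hLk n
  set k := blockIdx f n
  rcases le_or_gt (L m) (convDeg f.val k) with h | h
  · rw [card_filter_coords_orbit_eq hf h hk]
    have := excess_nonneg f L m n
    calc _ = ((Nat.card F : ℝ) ^ L m)⁻¹ * mass F L n := by
          rw [mass]
          ring
      _ ≤ _ := by gcongr; linarith
  · rcases Finset.eq_empty_or_nonempty ((polyEq F n).filter fun Q =>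
        coords F (L m) (orbit f Q) = coords F (L m) (orbit f P)) with h0 | ⟨Q, hQ⟩
    · rw [h0, Finset.card_empty, Nat.cast_zero, zero_mul]
      have := excess_nonneg f L m n
      have := mass_nonneg (F := F) L n
      positivity
    · rw [Finset.mem_filter, mem_polyEq] at hQ
      have hS : (Q - P).degree = n := by
        rw [degree_sub_eq_left_of_degree_lt, hQ.1]
        rw [hQ.1, hP]
        exact_mod_cast hmn
      have hlt := add_lt_of_coords_orbit_eq_zero hf (eq_zero_of_coords_orbit_eq_zero hf k) hk hk'
        h.le hS (by rw [map_sub, map_sub, hQ.2, sub_self])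
      -- From `n ≥ n_k` and `hlt` comes `L m < n_{k+1}`, so `L m` and `n` lie in the same block.
      -- This lets `excess` depend on `n` only through the count and the cutoff.
      have hkm : blockIdx f (L m) = k := blockIdx_eq hf h.le (by omega)
      -- Equidistribution is exact only up to level `n_k`, so the condition is weakened to that
      -- level. The loss is tolerable because `L n ≥ n_{k+1}`.
      have hcard : (((polyEq F n).filter fun Q =>
          coords F (L m) (orbit f Q) = coords F (L m) (orbit f P)).card : ℝ) ≤
          (polyEq F n).card * ((Nat.card F : ℝ) ^ convDeg f.val k)⁻¹ := by
        rw [← card_filter_coords_orbit_eq hf le_rfl hk (coords F _ (orbit f P))]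
        exact_mod_cast Finset.card_le_card fun R hR =>
          Finset.mem_filter.mpr ⟨(Finset.mem_filter.mp hR).1,
            coords_eq_of_le h.le (Finset.mem_filter.mp hR).2⟩
      have hexc : excess f L m n = (polyEq F n).card *
          ((Nat.card F : ℝ) ^ (convDeg f.val k + convDeg f.val (k + 1) - L m))⁻¹ := by
        rw [excess, hkm, if_pos hlt]
      have hpow : ((Nat.card F : ℝ) ^ convDeg f.val k)⁻¹ *
          ((Nat.card F : ℝ) ^ convDeg f.val (k + 1))⁻¹ = ((Nat.card F : ℝ) ^ L m)⁻¹ *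
          ((Nat.card F : ℝ) ^ (convDeg f.val k + convDeg f.val (k + 1) - L m))⁻¹ := by
        rw [← mul_inv, ← mul_inv, ← pow_add, ← pow_add]
        congr 2
        omega
      calc _ ≤ (polyEq F n).card * ((Nat.card F : ℝ) ^ convDeg f.val k)⁻¹ *
            ((Nat.card F : ℝ) ^ convDeg f.val (k + 1))⁻¹ := by
            gcongr
            exact (one_lt_q F).le
        _ = ((Nat.card F : ℝ) ^ L m)⁻¹ * excess f L m n := by
            rw [mul_assoc, hpow, hexc]
            ring
        _ ≤ _ := by
            gcongr
            linarith [mass_nonneg (F := F) L n]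

theorem pairMass_le_of_lt (hf : IsIrrational f.val) (hL : Monotone L)
    (hLk : ∀ n, convDeg f.val (blockIdx f n + 1) ≤ L n) {m n : ℕ} (hmn : m < n) :
    pairMass f L m n ≤ mass F L m * mass F L n + mass F L m * excess f L m n := by
  classical
  rw [← mul_add, mass, mul_assoc, ← nsmul_eq_mul, ← Finset.sum_const, pairMass]
  refine Finset.sum_le_sum fun P hP => ?_
  rw [sum_haar_inter_eq (hL hmn.le) P]
  exact card_filter_mul_le hf hLk hmn (mem_polyEq.mp hP)

/-- Both excess terms and the diagonal term appear so that one bound, symmetric in `m` and `n`, can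
be summed over the square; each contributes one unit to the constant `3` of `sum_pairMass_le`. -/
theorem pairMass_le (hf : IsIrrational f.val) (hL : Monotone L)
    (hLk : ∀ n, convDeg f.val (blockIdx f n + 1) ≤ L n) (m n : ℕ) :
    pairMass f L m n ≤ mass F L m * mass F L n + mass F L m * excess f L m n +
      mass F L n * excess f L n m + if m = n then mass F L n else 0 := by
  have h1 := mul_nonneg (mass_nonneg (F := F) L m) (excess_nonneg f L m n)
  have h2 := mul_nonneg (mass_nonneg (F := F) L n) (excess_nonneg f L n m)
  have h3 := mul_nonneg (mass_nonneg (F := F) L m) (mass_nonneg (F := F) L n)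
  rcases lt_trichotomy m n with h | rfl | h
  · rw [if_neg h.ne]
    linarith [pairMass_le_of_lt hf hL hLk h]
  · rw [if_pos rfl]
    linarith [pairMass_self_le hf hLk m]
  · rw [if_neg h.ne', pairMass_comm]
    linarith [pairMass_le_of_lt hf hL hLk h, mul_comm (mass F L m) (mass F L n)]

theorem sum_pairMass_le (hf : IsIrrational f.val) (hL : Monotone L)
    (hLk : ∀ n, convDeg f.val (blockIdx f n + 1) ≤ L n) (N : ℕ) :
    ∑ m ∈ Finset.range N, ∑ n ∈ Finset.range N, pairMass f L m n ≤
      (∑ n ∈ Finset.range N, mass F L n) ^ 2 + 3 * ∑ n ∈ Finset.range N, mass F L n := by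
  have hexc : ∑ m ∈ Finset.range N, ∑ n ∈ Finset.range N, mass F L m * excess f L m n ≤
      ∑ n ∈ Finset.range N, mass F L n := by
    refine Finset.sum_le_sum fun m _ => ?_
    rw [← Finset.mul_sum]
    exact mul_le_of_le_one_right (mass_nonneg L m) (sum_excess_le_one f L m N)
  have hexc' : ∑ m ∈ Finset.range N, ∑ n ∈ Finset.range N, mass F L n * excess f L n m ≤
      ∑ n ∈ Finset.range N, mass F L n := by
    rw [Finset.sum_comm]
    exact hexc
  have hdiag : ∑ m ∈ Finset.range N, ∑ n ∈ Finset.range N, (if m = n then mass F L n else 0) =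
      ∑ n ∈ Finset.range N, mass F L n := by
    refine Finset.sum_congr rfl fun m hm => ?_
    rw [Finset.sum_ite_eq, if_pos hm]
  refine (Finset.sum_le_sum fun m _ => Finset.sum_le_sum fun n _ =>
    pairMass_le hf hL hLk m n).trans ?_
  simp only [Finset.sum_add_distrib]
  rw [hdiag, ← Finset.sum_mul_sum, ← sq]
  linarith

theorem pairwiseDisjoint_polyEq (s : Set ℕ) : s.PairwiseDisjoint (polyEq F) := by
  intro m _ n _ hmn
  refine Finset.disjoint_left.mpr fun Q hm hn => hmn ?_
  rw [mem_polyEq] at hm hn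
  exact_mod_cast hm.symm.trans hn

theorem ae_infinite_of_tendsto_sum_mass (hf : IsIrrational f.val) (hL : Monotone L)
    (hLk : ∀ n, convDeg f.val (blockIdx f n + 1) ≤ L n)
    (hdiv : Tendsto (fun N => ∑ n ∈ Finset.range N, mass F L n) atTop atTop) :
    ∀ᵐ g ∂haar F, {Q : F[X] | g ∈ cyl (orbit f Q) (L Q.natDegree)}.Infinite := by
  classical
  have hsum : ∀ N, ∑ Q ∈ (Finset.range N).biUnion (polyEq F),
      (haar F).real (cyl (orbit f Q) (L Q.natDegree)) =
        ∑ n ∈ Finset.range N, mass F L n := by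
    intro N
    rw [Finset.sum_biUnion (pairwiseDisjoint_polyEq _)]
    refine Finset.sum_congr rfl fun n _ => ?_
    rw [mass, ← nsmul_eq_mul, ← Finset.sum_const]
    refine Finset.sum_congr rfl fun Q hQ => ?_
    rw [natDegree_eq_of_degree_eq_some (mem_polyEq.mp hQ), haar_real_cyl]
  refine ae_infinite_of_second_moment (fun Q => measurableSet_cyl _ _)
    (fun N => (Finset.range N).biUnion (polyEq F)) (C := 3) (fun N => ?_) ?_
  · rw [hsum]
    refine le_of_eq_of_le ?_ (sum_pairMass_le hf hL hLk N)
    simp only [Finset.sum_biUnion (pairwiseDisjoint_polyEq _)]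
    refine Finset.sum_congr rfl fun m _ => ?_
    rw [Finset.sum_comm]
    refine Finset.sum_congr rfl fun n _ => ?_
    refine Finset.sum_congr rfl fun P hP => Finset.sum_congr rfl fun Q hQ => ?_
    rw [natDegree_eq_of_degree_eq_some (mem_polyEq.mp hP),
      natDegree_eq_of_degree_eq_some (mem_polyEq.mp hQ)]
  · simpa only [hsum] using hdiv

theorem tendsto_sum_mass
    (h : ∑' n : ℕ, (Nat.card F : ENNReal) ^ ((n : ℤ) - (L n : ℤ)) = ⊤) :
    Tendsto (fun N => ∑ n ∈ Finset.range N, mass F L n) atTop atTop := by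
  have hq : (0 : ℝ) < Nat.card F := by linarith [one_lt_q F]
  rw [← not_summable_iff_tendsto_nat_atTop_of_nonneg (mass_nonneg L)]
  intro hs
  refine hs.tsum_ofReal_ne_top (top_le_iff.mp (h.symm.le.trans (ENNReal.tsum_le_tsum fun n => ?_)))
  have hqe : (Nat.card F : ENNReal) ≠ 0 := by exact_mod_cast Nat.card_pos.ne'
  rw [ENNReal.zpow_sub hqe (ENNReal.natCast_ne_top _), zpow_natCast, zpow_natCast, mass,
    ENNReal.ofReal_mul (by positivity), ENNReal.ofReal_inv_of_pos (by positivity),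
    ENNReal.ofReal_pow hq.le, ENNReal.ofReal_natCast, ENNReal.ofReal_natCast]
  gcongr
  exact_mod_cast pow_le_card_polyEq (F := F) n

end Divergence

/-! ### The convergence case: economical covers. -/

section Convergence

variable {F : Type*} [Field F] [Finite F] {f : UnitBall F} {l : ℕ → ℕ}

theorem one_le_card_ennreal : (1 : ENNReal) ≤ Nat.card F := by
  exact_mod_cast Nat.card_pos (α := F)

theorem haar_biUnion_cyl_le {s : Finset F[X]} {a : ℕ} (hs : s.card ≤ Nat.card F ^ a) (b : ℕ)
    (f : UnitBall F) :
    haar F (⋃ Q ∈ s, cyl (orbit f Q) b) ≤ (Nat.card F : ENNReal) ^ ((a : ℤ) - (b : ℤ)) := by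
  have hqe : (Nat.card F : ENNReal) ≠ 0 := by exact_mod_cast Nat.card_pos.ne'
  refine (measure_biUnion_finset_le s _).trans ?_
  simp only [haar_cyl, Finset.sum_const, nsmul_eq_mul]
  rw [ENNReal.zpow_sub hqe (ENNReal.natCast_ne_top _), zpow_natCast, zpow_natCast]
  gcongr
  exact_mod_cast hs

/-- The balls of the level of `nₖ` around all `{R f}` with `deg R < nₖ`. -/
def coarseCover (f : UnitBall F) (l : ℕ → ℕ) (k : ℕ) : Set (UnitBall F) :=
  ⋃ R ∈ polyLT F (convDeg f.val k), cyl (orbit f R) (l (convDeg f.val k))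

/-- A set that, together with `coarseCover`, covers the balls around `{Q f}`, `deg Q = n`. -/
def fineCover (f : UnitBall F) (l : ℕ → ℕ) (n : ℕ) : Set (UnitBall F) :=
  if convDeg f.val (blockIdx f n + 1) ≤ l n then ⋃ Q ∈ polyEq F n, cyl (orbit f Q) (l n)
  else ⋃ R ∈ polyLT F (convDeg f.val (blockIdx f n)), cyl (orbit f R)
    (convDeg f.val (blockIdx f n + 1) + convDeg f.val (blockIdx f n) - n - 1)

theorem mem_cover (hf : IsIrrational f.val) (hl : Monotone l) {n : ℕ} {Q : F[X]}
    (hQ : Q.degree = n) {g : UnitBall F} (hg : g ∈ cyl (orbit f Q) (l n)) :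
    g ∈ coarseCover f l (blockIdx f n) ∨ g ∈ fineCover f l n := by
  have hk := convDeg_blockIdx_le hf n
  have hk' := lt_convDeg_blockIdx_succ hf n
  rw [fineCover, coarseCover]
  set k := blockIdx f n
  split_ifs with h
  · right
    exact Set.mem_biUnion (mem_polyEq.mpr hQ) hg
  · obtain ⟨A, R, rfl, hA, hd, hR⟩ := exists_eq_mul_convDen_add hf hQ hk
    have hR' : R ∈ polyLT F (convDeg f.val k) := mem_polyLT.mpr hR
    -- As `deg A = n - n_k`, the order of `{A Q_k f}` is `n_{k+1} + n_k - n`; the level is one less,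
    -- the last at which all coefficients vanish.
    have hz : coords F (convDeg f.val (k + 1) + convDeg f.val k - n - 1)
        (orbit f (A * convDen f.val k)) = 0 :=
      (coords_orbit_mul_convDen_eq_zero_iff hf hA (by omega)).mpr (by omega)
    have hz' : coords F (convDeg f.val (k + 1) + convDeg f.val k - n - 1)
        (orbit f (A * convDen f.val k + R)) =
        coords F (convDeg f.val (k + 1) + convDeg f.val k - n - 1) (orbit f R) := by
      rw [map_add, map_add, hz, zero_add]
    -- If `l n` is at most this level, the ball around `{Qf}` is a ball around `{Rf}`; enlarging it
    -- to level `l (n_k)` removes the dependence on `n`, so it is counted once per block. Otherwise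
    -- it lies in the ball of this level around `{Rf}`.
    rcases le_total (l n) (convDeg f.val (k + 1) + convDeg f.val k - n - 1) with h' | h'
    · left
      refine Set.mem_biUnion hR' ?_
      have h1 : l (convDeg f.val k) ≤ l n := hl hk
      exact (coords_eq_of_le (h1.trans h') hz').symm.trans (coords_eq_of_le h1 hg)
    · right
      exact Set.mem_biUnion hR' (hz'.symm.trans (coords_eq_of_le h' hg))

/-- In the second branch of `fineCover`, `q^(n_k)` balls of level `n_{k+1} + n_k - n - 1` have total
measure `q^(n + 1 - n_{k+1})`, and there `n_{k+1}` is the maximum. -/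
theorem haar_fineCover_le (hf : IsIrrational f.val) (n : ℕ) :
    haar F (fineCover f l n) ≤ (Nat.card F : ENNReal) ^
      ((n + 1 : ℤ) - max (convDeg f.val (blockIdx f n + 1) : ℤ) (l n : ℤ)) := by
  have hk := convDeg_blockIdx_le hf n
  have hk' := lt_convDeg_blockIdx_succ hf n
  rw [fineCover]
  split_ifs with h
  · refine (haar_biUnion_cyl_le (a := n + 1) ?_ _ f).trans (le_of_eq ?_)
    · rw [card_polyEq]
      exact Nat.sub_le _ _
    · congr 1
      omega
  · refine (haar_biUnion_cyl_le (card_polyLT F _).le _ f).trans (le_of_eq ?_)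
    congr 1
    omega

/-- The bound is `q` times the term of the series at `n = n_{k+1} - 1`, the last index of block `k`.
When `l (n_{k+1}) ≤ n_{k+1}` it equals `1` and is trivial. -/
theorem haar_coarseCover_succ_le (hf : IsIrrational f.val) (hl : Monotone l) (k : ℕ) :
    haar F (coarseCover f l (k + 1)) ≤ (Nat.card F : ENNReal) ^
      (((convDeg f.val (k + 1) - 1 : ℕ) + 1 : ℤ) -
        max (convDeg f.val (blockIdx f (convDeg f.val (k + 1) - 1) + 1) : ℤ)
          (l (convDeg f.val (k + 1) - 1) : ℤ)) := by
  have hlt := strictMono_convDeg hf (Nat.lt_add_one k)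
  have hb : blockIdx f (convDeg f.val (k + 1) - 1) = k := blockIdx_eq hf (by omega) (by omega)
  have hl' : l (convDeg f.val (k + 1) - 1) ≤ l (convDeg f.val (k + 1)) := hl (Nat.sub_le _ _)
  have h1 := haar_biUnion_cyl_le (card_polyLT F (convDeg f.val (k + 1))).le
    (l (convDeg f.val (k + 1))) f
  rw [hb]
  rcases le_total (l (convDeg f.val (k + 1))) (convDeg f.val (k + 1)) with h | h
  · refine prob_le_one.trans (le_of_eq ?_)
    rw [← zpow_zero (Nat.card F : ENNReal)]
    congr 1
    omega
  · exact h1.trans (ENNReal.zpow_le_of_le one_le_card_ennreal (by omega))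

theorem ae_finite_of_tsum_ne_top (hf : IsIrrational f.val) (hl : Monotone l)
    (h : ∑' n : ℕ, (Nat.card F : ENNReal) ^
      ((n : ℤ) - max (convDeg f.val (blockIdx f n + 1) : ℤ) (l n : ℤ)) ≠ ⊤) :
    ∀ᵐ g ∂haar F, {Q : F[X] | ∃ n : ℕ, Q.degree = n ∧ g ∈ cyl (orbit f Q) (l n)}.Finite := by
  have hqe : (Nat.card F : ENNReal) ≠ 0 := by exact_mod_cast Nat.card_pos.ne'
  set t : ℕ → ENNReal := fun n => (Nat.card F : ENNReal) ^
    ((n + 1 : ℤ) - max (convDeg f.val (blockIdx f n + 1) : ℤ) (l n : ℤ)) with ht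
  have htt : ∑' n, t n ≠ ⊤ := by
    have : ∀ n, t n = (Nat.card F : ENNReal) * (Nat.card F : ENNReal) ^
        ((n : ℤ) - max (convDeg f.val (blockIdx f n + 1) : ℤ) (l n : ℤ)) := by
      intro n
      rw [ht]
      dsimp only
      rw [add_comm (n : ℤ) 1, add_sub_assoc,
        ENNReal.zpow_add hqe (ENNReal.natCast_ne_top _), zpow_one]
    simp_rw [this]
    rw [ENNReal.tsum_mul_left]
    exact ENNReal.mul_ne_top (ENNReal.natCast_ne_top _) h
  have hfine : ∑' n, haar F (fineCover f l n) ≠ ⊤ :=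
    ne_top_of_le_ne_top htt (ENNReal.tsum_le_tsum fun n => haar_fineCover_le hf n)
  have hinj : Function.Injective fun k => convDeg f.val (k + 1) - 1 := by
    have hm := strictMono_convDeg hf
    intro j k hjk
    have h1 := hm j.succ_pos
    have h2 := hm k.succ_pos
    simp only [Nat.succ_eq_add_one] at hjk h1 h2
    have h3 := hm.injective (show convDeg f.val (j + 1) = convDeg f.val (k + 1) by omega)
    omega
  -- Different `k` are charged to different terms of `t`, so the sum is dominated by that of `t`.
  -- Block `0` has no preceding term, but it contains only finitely many degrees.
  have hcoarse : ∑' k, haar F (coarseCover f l (k + 1)) ≠ ⊤ :=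
    ne_top_of_le_ne_top htt ((ENNReal.tsum_le_tsum fun k =>
      haar_coarseCover_succ_le hf hl k).trans (ENNReal.tsum_comp_le_tsum_of_injective hinj t))
  filter_upwards [ae_finite_setOfPred_mem hfine, ae_finite_setOfPred_mem hcoarse] with g h1 h2
  obtain ⟨K, hK⟩ := h2.bddAbove
  obtain ⟨N, hN⟩ := h1.bddAbove
  refine (finite_degree_lt F (N + convDeg f.val (K + 2) + 1)).subset ?_
  rintro Q ⟨n, hQ, hg⟩
  have hn : n < N + convDeg f.val (K + 2) + 1 := by
    rcases mem_cover hf hl hQ hg with hc | hc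
    · have hb : blockIdx f n ≤ K + 1 := by
        rcases Nat.eq_zero_or_eq_succ_pred (blockIdx f n) with h0 | h0
        · omega
        · rw [h0] at hc
          have := hK hc
          omega
      have := lt_convDeg_blockIdx_succ hf n
      have := (strictMono_convDeg hf).monotone (show blockIdx f n + 1 ≤ K + 2 by omega)
      omega
    · have := hN hc
      omega
  change Q.degree < _
  rw [hQ]
  exact_mod_cast hn

end Convergence

/-! ### Regrouping the series by blocks. -/

section Main

variable {F : Type*} [Field F] [Finite F] {f : UnitBall F}

/-- The blocks partition the natural numbers, so the first `K` blocks give the partial sum over `n <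
n_K`; these partial sums are cofinal. -/
theorem tsum_sum_Ico_convDeg (hf : IsIrrational f.val) (t : ℕ → ℕ → ENNReal) :
    ∑' k, ∑ n ∈ Finset.Ico (convDeg f.val k) (convDeg f.val (k + 1)), t k n =
      ∑' n, t (blockIdx f n) n := by
  have hm := strictMono_convDeg hf
  rw [ENNReal.tsum_eq_iSup_nat, ENNReal.tsum_eq_iSup_nat' hm.tendsto_atTop]
  congr 1
  funext K
  induction K with
  | zero => simp [convDeg_zero]
  | succ K ih =>
    rw [Finset.sum_range_succ, ih, ← Finset.sum_range_add_sum_Ico _ (hm (Nat.lt_add_one K)).le]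
    congr 1
    refine Finset.sum_congr rfl fun n hn => ?_
    rw [Finset.mem_Ico] at hn
    rw [blockIdx_eq hf hn.1 hn.2]

end Main

end FormalLaurent

end

open FormalLaurent in
theorem mainTheorem5 {F : Type*} [Field F] [Finite F] (l : ℕ → ℕ) (hl : Monotone l)
    (f : UnitBall F) (hf : IsIrrational f.val) :
    ∀ᵐ g : UnitBall F ∂(haar F),
      ({Q : Polynomial F | ∃ n : ℕ, Q.degree = n ∧
          absVal (fract (ofPoly Q * f.val) - g.val) < 1 / (Nat.card F : ℝ) ^ l n}.Infinite ↔
        ∑' k : ℕ, ∑ n ∈ Finset.Ico (convDeg f.val k) (convDeg f.val (k + 1)),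
          (Nat.card F : ENNReal) ^ ((n : ℤ) - max (convDeg f.val (k + 1) : ℤ) (l n : ℤ)) = ⊤) := by
  have hset : ∀ g : UnitBall F, {Q : Polynomial F | ∃ n : ℕ, Q.degree = n ∧
      absVal (fract (ofPoly Q * f.val) - g.val) < 1 / (Nat.card F : ℝ) ^ l n} =
      {Q : Polynomial F | ∃ n : ℕ, Q.degree = n ∧ g ∈ cyl (orbit f Q) (l n)} := by
    intro g
    ext Q
    refine exists_congr fun n => and_congr_right fun _ => ?_
    rw [← orbit_val, absVal_sub_lt_iff, mem_cyl]
  simp_rw [hset]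
  rw [tsum_sum_Ico_convDeg hf fun k n =>
    (Nat.card F : ENNReal) ^ ((n : ℤ) - max (convDeg f.val (k + 1) : ℤ) (l n : ℤ))]
  by_cases h : ∑' n : ℕ, (Nat.card F : ENNReal) ^
      ((n : ℤ) - max (convDeg f.val (blockIdx f n + 1) : ℤ) (l n : ℤ)) = ⊤
  -- Raising the level to `L` shrinks the balls, so infinitely many hits for `L` give infinitely
  -- many for `l`.
  · let L : ℕ → ℕ := fun n => max (convDeg f.val (blockIdx f n + 1)) (l n)
    have hL : Monotone L := fun m n hmn => max_le_max
      ((strictMono_convDeg hf).monotone (Nat.succ_le_succ (monotone_blockIdx hf hmn))) (hl hmn)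
    have hdiv : ∑' n : ℕ, (Nat.card F : ENNReal) ^ ((n : ℤ) - (L n : ℤ)) = ⊤ := by
      rw [← h]
      simp only [L, Nat.cast_max]
    filter_upwards [ae_infinite_of_tendsto_sum_mass hf hL (fun n => le_max_left _ _)
      (tendsto_sum_mass hdiv)] with g hg
    -- The zero polynomial is discarded: its `natDegree` is `0`, but its `degree` is not a natural
    -- number.
    refine iff_of_true ((hg.sdiff (Set.finite_singleton 0)).mono ?_) h
    rintro Q ⟨hQ, hQ0⟩
    exact ⟨Q.natDegree, Polynomial.degree_eq_natDegree hQ0,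
      coords_eq_of_le (le_max_right _ _) hQ⟩
  · filter_upwards [ae_finite_of_tsum_ne_top hf hl h] with g hg
    exact iff_of_false (Set.not_infinite.mpr hg) h
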